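/- View meromorphic functions on $\mathbb C$ as holomorphic maps $F\colon\mathbb C\to\widehat{\mathbb C}=\mathbb C\cup\{\infty\}$ (the constant $\infty$ included), and let $\mathcal M$ be the space of all of them, with the topology of locally uniform convergence in the spherical metric of $\widehat{\mathbb C}$ and its Borel $\sigma$-algebra. Let $\lambda$ be a probability measure on $\mathcal M$ that is invariant under all translations $(\tau_wF)(z)=F(z+w)$, $w\in\mathbb C$, and non-trivial, that is, the set of constant functions has $\lambda$-measure zero. Then, for $\lambda$-a.e. $F\in\mathcal M$, \[ \liminf_{R\to\infty}\frac{T_F(R)}{R^2}>0, \] where \[ T_F(R)=\int_0^R\Bigl(\frac1\pi\int_{|z|<r}F^{\#}(z)^2\,dA(z)\Bigr)\frac{dr}{r},\qquad F^{\#}=\frac{|F'|}{1+|F|^2}, \] is the Ahlfors–Shimizu form of the Nevanlinna characteristic, $F^{\#}$ is the spherical derivative (computed with $1/F$ in place of $F$ where $F=\infty$), $A$ is area measure, and the liminf may be $+\infty$. -/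

import Mathlib

open Filter Topology MeasureTheory
open scoped ENNReal OnePoint

noncomputable section

/-- The Riemann sphere is `OnePoint ℂ`. This is its spherical (chordal) metric, normalised so that
its length element is `|dw| / (1 + |w|²)` (the sphere has diameter one and area `π`). -/
def sphericalDist : OnePoint ℂ → OnePoint ℂ → ℝ
  | OnePoint.infty, OnePoint.infty => 0
  | OnePoint.infty, OnePoint.some w => 1 / √(1 + ‖w‖ ^ 2)
  | OnePoint.some z, OnePoint.infty => 1 / √(1 + ‖z‖ ^ 2)
  | OnePoint.some z, OnePoint.some w => ‖z - w‖ / (√(1 + ‖z‖ ^ 2) * √(1 + ‖w‖ ^ 2))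

/-- The affine coordinate `w` on the sphere minus `∞` (value `0` at `∞`, which is not in the
domain of this chart). -/
def sphereCoord : OnePoint ℂ → ℂ
  | OnePoint.infty => 0
  | OnePoint.some w => w

/-- The coordinate `1 / w` on the sphere minus `0`, with value `0` at `∞` (the value at the point
`0`, which is not in the domain of this chart, is `0⁻¹ = 0`). -/
def sphereCoordInfty : OnePoint ℂ → ℂ
  | OnePoint.infty => 0
  | OnePoint.some w => w⁻¹

/-- The inverse of the chart at infinity: `ζ ↦ 1 / ζ`, with `0 ↦ ∞`. -/
def sphereInvChart (ζ : ℂ) : OnePoint ℂ :=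
  open Classical in if ζ = 0 then OnePoint.infty else ((ζ⁻¹ : ℂ) : OnePoint ℂ)

/-- A meromorphic function on the plane, as a holomorphic map from `ℂ` to the Riemann sphere: near
every point, `F` or `1 / F` is an analytic function. The constant `∞` is included. -/
@[ext]
structure MeromorphicFun where
  toFun : ℂ → OnePoint ℂ
  holomorphic' : ∀ z₀ : ℂ,
    (∃ f : ℂ → ℂ, AnalyticAt ℂ f z₀ ∧ ∀ᶠ z in 𝓝 z₀, toFun z = ((f z : ℂ) : OnePoint ℂ)) ∨
    (∃ g : ℂ → ℂ, AnalyticAt ℂ g z₀ ∧ ∀ᶠ z in 𝓝 z₀, toFun z = sphereInvChart (g z))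

namespace MeromorphicFun

instance : CoeFun MeromorphicFun (fun _ => ℂ → OnePoint ℂ) := ⟨toFun⟩

/-- The functions that are `ε`-close to `F` at all points of `K`, in the spherical metric. -/
def uniformBall (F : MeromorphicFun) (K : Set ℂ) (ε : ℝ) : Set MeromorphicFun :=
  {G | ∀ z ∈ K, sphericalDist (F z) (G z) < ε}

/-- The topology of locally uniform convergence in the spherical metric. -/
instance : TopologicalSpace MeromorphicFun :=
  TopologicalSpace.generateFrom
    {U | ∃ (F : MeromorphicFun) (K : Set ℂ) (ε : ℝ), IsCompact K ∧ 0 < ε ∧ U = F.uniformBall K ε}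

/-- The Borel sigma-algebra of the topology of locally uniform convergence. -/
instance : MeasurableSpace MeromorphicFun := borel MeromorphicFun

instance : BorelSpace MeromorphicFun := ⟨rfl⟩

theorem tendsto_add_right (w z₀ : ℂ) : Tendsto (fun z : ℂ => z + w) (𝓝 z₀) (𝓝 (z₀ + w)) :=
  (continuous_id.add continuous_const).tendsto z₀

/-- The translate `(τ_w F)(z) = F (z + w)`. -/
def translate (w : ℂ) (F : MeromorphicFun) : MeromorphicFun where
  toFun z := F (z + w)
  holomorphic' z₀ := by
    have hA : AnalyticAt ℂ (fun z : ℂ => z + w) z₀ := analyticAt_id.add analyticAt_const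
    rcases F.holomorphic' (z₀ + w) with ⟨f, hf, h⟩ | ⟨g, hg, h⟩
    · exact Or.inl ⟨fun z => f (z + w), AnalyticAt.fun_comp hf hA,
        (tendsto_add_right w z₀).eventually h⟩
    · exact Or.inr ⟨fun z => g (z + w), AnalyticAt.fun_comp hg hA,
        (tendsto_add_right w z₀).eventually h⟩

/-- The action of `ℂ` on meromorphic functions by translations, `w +ᵥ F = τ_w F`. -/
instance : AddAction ℂ MeromorphicFun where
  vadd := translate
  zero_vadd F := by
    apply MeromorphicFun.ext
    funext z
    exact congrArg F (add_zero z)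
  add_vadd v w F := by
    apply MeromorphicFun.ext
    funext z
    exact congrArg F (add_assoc z v w).symm

/-- The set of constant functions, the constant `∞` among them. -/
def constants : Set MeromorphicFun := {F | ∃ c : OnePoint ℂ, ∀ z, F z = c}

/-- The spherical derivative `|F'| / (1 + |F|²)`; at a point where `F = ∞` it is computed with
`1 / F`, which has the same spherical derivative as `F`. -/
def sphericalDeriv (F : MeromorphicFun) (z : ℂ) : ℝ :=
  open Classical in
  if F z = OnePoint.infty then
    ‖deriv (fun w => sphereCoordInfty (F w)) z‖ / (1 + ‖sphereCoordInfty (F z)‖ ^ 2)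
  else
    ‖deriv (fun w => sphereCoord (F w)) z‖ / (1 + ‖sphereCoord (F z)‖ ^ 2)

/-- The spherical area, divided by `π`, of the image of the disk of radius `r`, with
multiplicities: `(1 / π) ∫_{|z| < r} F^#(z)² dA(z)`. -/
def sphericalArea (F : MeromorphicFun) (r : ℝ) : ℝ≥0∞ :=
  ENNReal.ofReal (1 / Real.pi) *
    ∫⁻ z in Metric.ball (0 : ℂ) r, ENNReal.ofReal (F.sphericalDeriv z ^ 2)

/-- The Nevanlinna characteristic in the Ahlfors–Shimizu form,
`T_F(R) = ∫_0^R ((1 / π) ∫_{|z| < r} F^#(z)² dA(z)) dr / r`, as a Lebesgue integral of a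
non-negative function. -/
def characteristic (F : MeromorphicFun) (R : ℝ) : ℝ≥0∞ :=
  ∫⁻ r in Set.Ioo (0 : ℝ) R, F.sphericalArea r * ENNReal.ofReal (1 / r)

end MeromorphicFun

end

/-! Call a point z bad for F if some disk about z, of integer radius m ≤ N, has image area at most ε
m². By a Vitali covering, the bad points in the disk of radius N carry image area at most 144 ε N².
Averaging over translations by z in that disk, with invariance of the measure and Tonelli, turns
this into a bound 144 ε, uniform in N, for the integral of F#(0)² over the functions having 0 as a
bad point (`setLIntegral_smallArea_le`).

A function of zero lower area density has 0 as a bad point for every ε once N is large. Letting N →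
∞ and then ε → 0 gives F#(0) = 0 almost surely on the set of such functions. This set is translation
invariant, so F# vanishes on a countable dense set, F is constant, and the set is null. Off it the
image area grows at least like r², and integrating against dr/r gives the claim. Neither an ergodic
theorem nor integrability of F#(0)² is needed. -/

/-! ### Covering estimate -/

/-- If every point of a subset of a disk is the centre of a disk with small integral of `g`, then
the integral of `g` over the subset is small. -/
theorem setLIntegral_le_of_forall_exists_ball {g : ℂ → ℝ≥0∞} {S : Set ℂ} {ε N : ℝ} (hε : 0 ≤ ε)
    (hS : S ⊆ Metric.ball 0 N)
    (h : ∀ z ∈ S, ∃ m : ℝ, 0 < m ∧ m ≤ N ∧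
      ∫⁻ u in Metric.ball z m, g u ≤ ENNReal.ofReal (ε * m ^ 2)) :
    ∫⁻ z in S, g z ≤ ENNReal.ofReal (144 * ε * N ^ 2) := by
  choose! m hm0 hmN hm using h
  -- Radii are divided by 6 so that the fivefold enlargements, being closed, still fit in the open
  -- disks of radius `m`.
  obtain ⟨u, huS, hdisj, hcov⟩ := Vitali.exists_disjoint_subfamily_covering_enlargement_closedBall
    S id (fun z => m z / 6) (N / 6) (fun z hz => by linarith [hmN z hz]) 5 (by norm_num)
  have hu : u.Countable := by
    refine hdisj.countable_of_nonempty_interior fun z hz => ?_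
    refine ⟨z, Metric.ball_subset_interior_closedBall (Metric.mem_ball_self ?_)⟩
    linarith [hm0 z (huS hz)]
  have : Countable u := hu
  have hsub : S ⊆ ⋃ b : u, Metric.ball (b : ℂ) (m b) := by
    intro z hz
    obtain ⟨b, hb, hzb⟩ := hcov z hz
    refine Set.mem_iUnion.2 ⟨⟨b, hb⟩, ?_⟩
    have h1 : z ∈ Metric.closedBall b (5 * (m b / 6)) :=
      hzb (Metric.mem_closedBall_self (by linarith [hm0 z hz]))
    refine Metric.closedBall_subset_ball ?_ h1
    linarith [hm0 b (huS hb)]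
  -- The disjoint small disks lie in the disk of radius N + N/6 ≤ 2N. Comparing areas gives the
  -- constant 144 = 6² · 2².
  have hvol : ∑' b : u, ENNReal.ofReal (m b / 6) ^ 2 ≤ ENNReal.ofReal (2 * N) ^ 2 := by
    have h1 : ∑' b : u, volume (Metric.ball (b : ℂ) (m b / 6)) ≤
        volume (Metric.ball (0 : ℂ) (2 * N)) := by
      rw [← measure_iUnion _ fun _ => measurableSet_ball]
      · refine measure_mono (Set.iUnion_subset fun b => Metric.ball_subset_ball' ?_)
        have h1 := hmN b (huS b.2)
        have h2 := hm0 b (huS b.2)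
        have h3 := Metric.mem_ball.1 (hS (huS b.2))
        linarith
      · intro a b hab
        exact (hdisj a.2 b.2 (fun h => hab (Subtype.ext h))).mono Metric.ball_subset_closedBall
          Metric.ball_subset_closedBall
    simp only [Complex.volume_ball] at h1
    rw [ENNReal.tsum_mul_right] at h1
    exact (ENNReal.mul_le_mul_iff_left (by simpa using NNReal.pi_ne_zero) ENNReal.coe_ne_top).1 h1
  calc ∫⁻ z in S, g z ≤ ∫⁻ z in ⋃ b : u, Metric.ball (b : ℂ) (m b), g z := lintegral_mono_set hsub
    _ ≤ ∑' b : u, ∫⁻ z in Metric.ball (b : ℂ) (m b), g z := lintegral_iUnion_le _ _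
    _ ≤ ∑' b : u, ENNReal.ofReal (36 * ε) * ENNReal.ofReal (m b / 6) ^ 2 := by
      refine ENNReal.tsum_le_tsum fun b => (hm b (huS b.2)).trans_eq ?_
      rw [← ENNReal.ofReal_pow (by linarith [hm0 b (huS b.2)]),
        ← ENNReal.ofReal_mul (by positivity)]
      congr 1
      ring
    _ ≤ ENNReal.ofReal (36 * ε) * ENNReal.ofReal (2 * N) ^ 2 := by
      rw [ENNReal.tsum_mul_left]
      gcongr
    _ ≤ ENNReal.ofReal (144 * ε * N ^ 2) := by
      rcases le_or_gt N 0 with hN | hN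
      · rw [ENNReal.ofReal_of_nonpos (p := 2 * N) (by linarith)]
        simp
      · rw [← ENNReal.ofReal_pow (by positivity), ← ENNReal.ofReal_mul (by positivity)]
        refine le_of_eq (congrArg _ ?_)
        ring

namespace MeromorphicFun

/-! ### Spherical metric and derivative in the two charts -/

theorem sphericalDist_coe (a b : ℂ) : sphericalDist (a : OnePoint ℂ) (b : OnePoint ℂ) =
    ‖a - b‖ / (√(1 + ‖a‖ ^ 2) * √(1 + ‖b‖ ^ 2)) := rfl

theorem sqrt_one_add_norm_inv_sq {a : ℂ} (ha : a ≠ 0) :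
    √(1 + ‖a⁻¹‖ ^ 2) = √(1 + ‖a‖ ^ 2) / ‖a‖ := by
  have h : 0 < ‖a‖ := norm_pos_iff.2 ha
  rw [eq_div_iff h.ne', ← Real.sqrt_sq h.le, ← Real.sqrt_mul (by positivity), Real.sqrt_sq h.le]
  congr 1
  rw [norm_inv]
  field_simp
  ring

/-- Inversion is an isometry of the sphere, so poles need no separate treatment after
`exists_local_chart`. -/
theorem sphericalDist_sphereInvChart (a b : ℂ) :
    sphericalDist (sphereInvChart a) (sphereInvChart b) =
      ‖a - b‖ / (√(1 + ‖a‖ ^ 2) * √(1 + ‖b‖ ^ 2)) := by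
  unfold sphereInvChart
  by_cases ha : a = 0 <;> by_cases hb : b = 0
  · simp only [ha, hb, if_true]
    simp [sphericalDist]
  · simp only [ha, hb, if_true, if_false]
    change 1 / √(1 + ‖b⁻¹‖ ^ 2) = _
    rw [sqrt_one_add_norm_inv_sq hb]
    simp
  · simp only [ha, hb, if_true, if_false]
    change 1 / √(1 + ‖a⁻¹‖ ^ 2) = _
    rw [sqrt_one_add_norm_inv_sq ha]
    simp
  · simp only [ha, hb, if_false]
    rw [sphericalDist_coe, sqrt_one_add_norm_inv_sq ha, sqrt_one_add_norm_inv_sq hb,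
      inv_sub_inv ha hb, norm_div, norm_mul, norm_sub_rev b a]
    have h : 0 < ‖a‖ := norm_pos_iff.2 ha
    have h' : 0 < ‖b‖ := norm_pos_iff.2 hb
    have : 0 < √(1 + ‖a‖ ^ 2) := by positivity
    have : 0 < √(1 + ‖b‖ ^ 2) := by positivity
    field_simp

theorem sphericalDeriv_of_eventually_coe {F : MeromorphicFun} {f : ℂ → ℂ} {z : ℂ}
    (h : ∀ᶠ w in 𝓝 z, F w = ((f w : ℂ) : OnePoint ℂ)) :
    F.sphericalDeriv z = ‖deriv f z‖ / (1 + ‖f z‖ ^ 2) := by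
  have hz := h.self_of_nhds
  have hd : (fun w => sphereCoord (F w)) =ᶠ[𝓝 z] f := by
    filter_upwards [h] with w hw
    rw [hw]; rfl
  rw [sphericalDeriv, if_neg (by rw [hz]; exact OnePoint.coe_ne_infty _), hd.deriv_eq]
  simp only [hd.self_of_nhds]

theorem sphericalDeriv_of_eventually_sphereInvChart {F : MeromorphicFun} {g : ℂ → ℂ} {z : ℂ}
    (hg : AnalyticAt ℂ g z) (h : ∀ᶠ w in 𝓝 z, F w = sphereInvChart (g w)) :
    F.sphericalDeriv z = ‖deriv g z‖ / (1 + ‖g z‖ ^ 2) := by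
  by_cases hz : g z = 0
  · have hd : (fun w => sphereCoordInfty (F w)) =ᶠ[𝓝 z] g := by
      filter_upwards [h] with w hw
      rw [hw, sphereInvChart]
      split_ifs with h0
      · rw [h0]; rfl
      · exact inv_inv _
    rw [sphericalDeriv, if_pos (by rw [h.self_of_nhds, hz, sphereInvChart, if_pos rfl]),
      hd.deriv_eq]
    simp only [hd.self_of_nhds]
  · have h' : ∀ᶠ w in 𝓝 z, F w = (((g w)⁻¹ : ℂ) : OnePoint ℂ) := by
      filter_upwards [h, hg.continuousAt.eventually_ne hz] with w hw h0
      rw [hw, sphereInvChart, if_neg h0]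
    rw [sphericalDeriv_of_eventually_coe h']
    have : deriv (fun w => (g w)⁻¹) z = -deriv g z / g z ^ 2 :=
      (hg.differentiableAt.hasDerivAt.inv hz).deriv
    rw [this, norm_div, norm_neg, norm_pow, norm_inv]
    have : 0 < ‖g z‖ := norm_pos_iff.2 hz
    field_simp
    ring

/-- Near every point, a meromorphic function is an analytic function followed by a chart of the
sphere. -/
theorem exists_local_chart (F : MeromorphicFun) (z₀ : ℂ) : ∃ (e : ℂ → OnePoint ℂ) (h : ℂ → ℂ),
    (∀ a b, sphericalDist (e a) (e b) = ‖a - b‖ / (√(1 + ‖a‖ ^ 2) * √(1 + ‖b‖ ^ 2))) ∧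
    AnalyticAt ℂ h z₀ ∧ (∀ᶠ z in 𝓝 z₀, F z = e (h z)) ∧
    ∀ᶠ z in 𝓝 z₀, F.sphericalDeriv z = ‖deriv h z‖ / (1 + ‖h z‖ ^ 2) := by
  rcases F.holomorphic' z₀ with ⟨f, hf, h⟩ | ⟨g, hg, h⟩
  · refine ⟨_, f, sphericalDist_coe, hf, h, ?_⟩
    filter_upwards [h.eventually_nhds] with z hz using sphericalDeriv_of_eventually_coe hz
  · refine ⟨_, g, sphericalDist_sphereInvChart, hg, h, ?_⟩
    filter_upwards [h.eventually_nhds, hg.eventually_analyticAt] with z hz hgz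
      using sphericalDeriv_of_eventually_sphereInvChart hgz hz

theorem continuous_sphericalDeriv (F : MeromorphicFun) : Continuous F.sphericalDeriv := by
  refine continuous_iff_continuousAt.2 fun z₀ => ?_
  obtain ⟨e, h, -, hh, -, hd⟩ := F.exists_local_chart z₀
  refine ContinuousAt.congr ?_ (hd.mono fun _ hz => hz.symm)
  exact hh.deriv.continuousAt.norm.div (continuousAt_const.add (hh.continuousAt.norm.pow 2))
    (by positivity)

theorem mem_constants_of_sphericalDeriv_eq_zero {F : MeromorphicFun}
    (hF : ∀ z, F.sphericalDeriv z = 0) : F ∈ constants := by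
  have : IsLocallyConstant F.toFun := by
    refine (IsLocallyConstant.iff_eventually_eq _).2 fun z₀ => ?_
    obtain ⟨e, h, -, hh, he, hd⟩ := F.exists_local_chart z₀
    obtain ⟨r, hr, hball⟩ := Metric.eventually_nhds_iff_ball.1
      (hd.and (he.and hh.eventually_analyticAt))
    filter_upwards [Metric.ball_mem_nhds z₀ hr] with z hz
    have hz₀ := Metric.mem_ball_self (x := z₀) hr
    have hconst : h z = h z₀ := by
      refine Metric.isOpen_ball.is_const_of_deriv_eq_zero (convex_ball z₀ r).isPreconnected
        (fun w hw => (hball w hw).2.2.differentiableAt.differentiableWithinAt)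
        (fun w hw => ?_) hz hz₀
      have := (hball w hw).1
      rw [hF w, eq_comm, div_eq_zero_iff] at this
      rcases this with h0 | h0
      · exact norm_eq_zero.1 h0
      · exact absurd h0 (by positivity)
    rw [(hball z hz).2.1, (hball z₀ hz₀).2.1, hconst]
  exact ⟨F 0, fun z => this.apply_eq_of_preconnectedSpace z 0⟩

/-- Expresses F# through countably many values of F, which makes it measurable in F. -/
theorem tendsto_sphericalDist_mul (F : MeromorphicFun) (z : ℂ) :
    Tendsto (fun n : ℕ => sphericalDist (F (z + 1 / ((n : ℂ) + 1))) (F z) * ((n : ℝ) + 1)) atTop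
      (𝓝 (F.sphericalDeriv z)) := by
  obtain ⟨e, h, hdist, hh, he, hd⟩ := F.exists_local_chart z
  have hu : Tendsto (fun n : ℕ => (1 : ℂ) / ((n : ℂ) + 1)) atTop (𝓝 0) :=
    tendsto_one_div_add_atTop_nhds_zero_nat (𝕜 := ℂ)
  have hu' : Tendsto (fun n : ℕ => (1 : ℂ) / ((n : ℂ) + 1)) atTop (𝓝[≠] 0) :=
    tendsto_nhdsWithin_iff.2 ⟨hu, Eventually.of_forall fun n => by
      simpa using Nat.cast_add_one_ne_zero n⟩
  have hzu : Tendsto (fun n : ℕ => z + 1 / ((n : ℂ) + 1)) atTop (𝓝 z) := by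
    simpa using hu.const_add z
  have hslope := (hh.differentiableAt.hasDerivAt.tendsto_slope_zero.comp hu').norm
  have hden : Tendsto (fun n : ℕ => √(1 + ‖h (z + 1 / ((n : ℂ) + 1))‖ ^ 2) * √(1 + ‖h z‖ ^ 2))
      atTop (𝓝 (√(1 + ‖h z‖ ^ 2) * √(1 + ‖h z‖ ^ 2))) :=
    (((hh.continuousAt.tendsto.comp hzu).norm.pow 2).const_add 1).sqrt.mul_const _
  rw [hd.self_of_nhds]
  have hpos : 0 < 1 + ‖h z‖ ^ 2 := by positivity
  rw [Real.mul_self_sqrt hpos.le] at hden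
  refine (hslope.div hden hpos.ne').congr' ?_
  filter_upwards [hzu.eventually he] with n hn
  rw [hn, he.self_of_nhds, hdist]
  have : ‖((n : ℂ) + 1)‖ = (n : ℝ) + 1 := by
    have : ((n : ℂ) + 1) = ((n + 1 : ℕ) : ℂ) := by push_cast; rfl
    rw [this, Complex.norm_natCast]; push_cast; rfl
  simp only [Function.comp, Pi.div_apply, norm_smul, one_div, inv_inv, this]
  ring

theorem sphericalDeriv_vadd (w : ℂ) (F : MeromorphicFun) (z : ℂ) :
    (w +ᵥ F).sphericalDeriv z = F.sphericalDeriv (z + w) := by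
  change (translate w F).sphericalDeriv z = _
  simp only [sphericalDeriv, translate]
  rw [deriv_comp_add_const (fun u => sphereCoord (F u)),
    deriv_comp_add_const (fun u => sphereCoordInfty (F u))]
  rfl

/-! ### Measurability in the function and in the point -/

/-- The constant function. -/
def const (c : OnePoint ℂ) : MeromorphicFun where
  toFun _ := c
  holomorphic' z₀ := by
    induction c using OnePoint.rec with
    | infty => exact Or.inr ⟨fun _ => 0, analyticAt_const, Eventually.of_forall fun _ => by
        simp [sphereInvChart]⟩
    | coe c => exact Or.inl ⟨fun _ => c, analyticAt_const, Eventually.of_forall fun _ => rfl⟩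

theorem measurable_sphericalDist_const (c : OnePoint ℂ) (z : ℂ) :
    Measurable fun F : MeromorphicFun => sphericalDist c (F z) := by
  refine measurable_of_Iio fun ε => ?_
  rcases le_or_gt ε 0 with hε | hε
  · convert MeasurableSet.empty
    ext F
    simp only [Set.mem_preimage, Set.mem_Iio, Set.mem_empty_iff_false, iff_false, not_lt]
    refine hε.trans ?_
    unfold sphericalDist
    split <;> positivity
  · refine IsOpen.measurableSet (TopologicalSpace.isOpen_generateFrom_of_mem ?_)
    -- The sublevel set is a subbasic open set: a ball about a constant, over a single point.
    refine ⟨const c, {z}, ε, isCompact_singleton, hε, ?_⟩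
    ext F
    simp [uniformBall, const]

theorem measurableSet_eq_infty (z : ℂ) : MeasurableSet {F : MeromorphicFun | F z = OnePoint.infty} := by
  convert measurable_sphericalDist_const OnePoint.infty z (measurableSet_singleton 0) using 1
  ext F
  simp only [Set.mem_ofPred_eq, Set.mem_preimage, Set.mem_singleton_iff]
  generalize F z = a
  induction a using OnePoint.rec with
  | infty => simp [sphericalDist]
  | coe a =>
    have : 0 < 1 / √(1 + ‖a‖ ^ 2) := by positivity
    exact iff_of_false (OnePoint.coe_ne_infty a) this.ne'

theorem measurable_of_eq_on_infty {α : Type*} [MeasurableSpace α] {z : ℂ}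
    {f g k : MeromorphicFun → α} (hf : Measurable f) (hg : Measurable g)
    (hkf : ∀ F : MeromorphicFun, F z = OnePoint.infty → k F = f F)
    (hkg : ∀ F : MeromorphicFun, F z ≠ OnePoint.infty → k F = g F) : Measurable k := by
  classical
  have hk : k = {F : MeromorphicFun | F z = OnePoint.infty}.piecewise f g := by
    funext F
    by_cases h : F z = OnePoint.infty
    · exact (hkf F h).trans (if_pos h).symm
    · exact (hkg F h).trans (if_neg h).symm
  rw [hk]
  exact Measurable.piecewise (measurableSet_eq_infty z) hf hg

/-- Away from ∞ this is, up to a factor depending on `c`, the ratio of the chordal distances to `c`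
and to ∞. -/
theorem measurable_norm_sub_sphereCoord (c : ℂ) (z : ℂ) :
    Measurable fun F : MeromorphicFun => ‖c - sphereCoord (F z)‖ := by
  refine measurable_of_eq_on_infty (z := z) (measurable_const (a := ‖c‖))
    (((measurable_sphericalDist_const c z).mul_const (√(1 + ‖c‖ ^ 2))).div
      (measurable_sphericalDist_const OnePoint.infty z)) (fun F hF => ?_) (fun F hF => ?_)
  · rw [hF]
    simp [sphereCoord]
  · obtain ⟨a, ha⟩ := OnePoint.ne_infty_iff_exists.1 hF
    simp only [Pi.div_apply, ← ha]
    rw [sphericalDist_coe]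
    change ‖c - a‖ = _ / (1 / √(1 + ‖a‖ ^ 2))
    have : 0 < √(1 + ‖a‖ ^ 2) := by positivity
    have : 0 < √(1 + ‖c‖ ^ 2) := by positivity
    field_simp

/-- Polarization recovers a from its distances to 0, 1 and i: 2 Re a = |a|² + 1 - |1 - a|², and
likewise for Im a. -/
theorem measurable_sphereCoord (z : ℂ) :
    Measurable fun F : MeromorphicFun => sphereCoord (F z) := by
  have h := fun c => measurable_norm_sub_sphereCoord c z
  have hre := ((((h 0).pow_const 2).add_const 1).sub ((h 1).pow_const 2)).div_const 2
  have him := ((((h 0).pow_const 2).add_const 1).sub ((h Complex.I).pow_const 2)).div_const 2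
  convert (Complex.measurable_ofReal.comp hre).add
    ((Complex.measurable_ofReal.comp him).mul_const Complex.I) using 1
  funext F
  generalize hc : sphereCoord (F z) = a
  apply Complex.ext <;>
  simp [hc, Complex.sq_norm, Complex.normSq_apply] <;> ring

open Classical in
theorem measurable_sphericalDist (z w : ℂ) :
    Measurable fun F : MeromorphicFun => sphericalDist (F z) (F w) := by
  have hz := measurable_sphereCoord z
  have hw := measurable_sphereCoord w
  refine measurable_of_eq_on_infty (z := z) (measurable_sphericalDist_const OnePoint.infty w)
    (measurable_of_eq_on_infty (z := w)
      (k := fun F => if F w = OnePoint.infty then sphericalDist OnePoint.infty (F z) else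
        ‖sphereCoord (F z) - sphereCoord (F w)‖ /
          (√(1 + ‖sphereCoord (F z)‖ ^ 2) * √(1 + ‖sphereCoord (F w)‖ ^ 2)))
      (measurable_sphericalDist_const OnePoint.infty z)
      ((hz.sub hw).norm.div ((((hz.norm.pow_const 2).const_add 1).sqrt).mul
        (((hw.norm.pow_const 2).const_add 1).sqrt)))
      (fun F hF => if_pos hF) (fun F hF => if_neg hF))
    (fun F hF => by rw [hF]) (fun F hF => ?_)
  obtain ⟨a, ha⟩ := OnePoint.ne_infty_iff_exists.1 hF
  simp only [← ha]
  generalize F w = b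
  induction b using OnePoint.rec with
  | infty => simp [sphericalDist]
  | coe b => simp only [OnePoint.coe_ne_infty, if_false]; rfl

theorem measurable_sphericalDeriv_apply (z : ℂ) :
    Measurable fun F : MeromorphicFun => F.sphericalDeriv z :=
  measurable_of_tendsto_metrizable (fun _ => (measurable_sphericalDist _ z).mul_const _)
    (tendsto_pi_nhds.2 fun F => F.tendsto_sphericalDist_mul z)

/-- Carathéodory: continuous in the point and measurable in the function implies jointly measurable.
-/
theorem measurable_sphericalDeriv :
    Measurable fun p : MeromorphicFun × ℂ => p.1.sphericalDeriv p.2 :=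
  (measurable_uncurry_of_continuous_of_measurable
    (u := fun (z : ℂ) (F : MeromorphicFun) => F.sphericalDeriv z)
    (fun F => F.continuous_sphericalDeriv) measurable_sphericalDeriv_apply).comp measurable_swap

theorem measurable_vadd_const (w : ℂ) : Measurable fun F : MeromorphicFun => w +ᵥ F := by
  refine Continuous.measurable (continuous_generateFrom_iff.2 ?_)
  rintro _ ⟨F, K, ε, hK, hε, rfl⟩
  refine TopologicalSpace.isOpen_generateFrom_of_mem
    ⟨(-w) +ᵥ F, (fun z => z + w) '' K, ε, hK.image (by fun_prop), hε, ?_⟩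
  ext G
  have hF : ∀ z, ((-w) +ᵥ F : MeromorphicFun) (z + w) = F z := fun z =>
    congrArg F (add_neg_cancel_right z w)
  simp only [uniformBall, Set.mem_preimage, Set.mem_ofPred_eq, Set.forall_mem_image, hF]
  rfl

theorem measurePreserving_vadd_const (μ : Measure MeromorphicFun)
    [VAddInvariantMeasure ℂ MeromorphicFun μ] (w : ℂ) :
    MeasurePreserving (fun F : MeromorphicFun => w +ᵥ F) μ μ :=
  ⟨measurable_vadd_const w, by
    ext s hs
    rw [Measure.map_apply (measurable_vadd_const w) hs,
      measure_preimage_vadd_of_nullMeasurableSet hs.nullMeasurableSet]⟩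

/-! ### Image areas and averaging over translations -/

/-- The spherical area of the image of the disk of radius `r` around `z`, with multiplicities. -/
noncomputable def imageArea (F : MeromorphicFun) (z : ℂ) (r : ℝ) : ℝ≥0∞ :=
  ∫⁻ u in Metric.ball z r, ENNReal.ofReal (F.sphericalDeriv u ^ 2)

/-- Moves the centre from the domain into the integrand, which gives measurability in the centre. -/
theorem imageArea_eq_lintegral_add (F : MeromorphicFun) (z : ℂ) (r : ℝ) :
    F.imageArea z r =
      ∫⁻ u in Metric.ball (0 : ℂ) r, ENNReal.ofReal (F.sphericalDeriv (u + z) ^ 2) := by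
  rw [imageArea, ← (measurePreserving_add_right volume z).setLIntegral_comp_preimage_emb
    (MeasurableEquiv.addRight z).measurableEmbedding]
  congr 2
  ext u
  simp [dist_eq_norm]

theorem imageArea_vadd (w : ℂ) (F : MeromorphicFun) (z : ℂ) (r : ℝ) :
    (w +ᵥ F).imageArea z r = F.imageArea (z + w) r := by
  simp only [imageArea_eq_lintegral_add, sphericalDeriv_vadd, add_assoc]

theorem measurable_imageArea (r : ℝ) :
    Measurable fun p : MeromorphicFun × ℂ => p.1.imageArea p.2 r := by
  simp only [imageArea_eq_lintegral_add]
  refine Measurable.lintegral_prod_right'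
    (f := fun q : (MeromorphicFun × ℂ) × ℂ =>
      ENNReal.ofReal (q.1.1.sphericalDeriv (q.2 + q.1.2) ^ 2))
    ?_
  have : Measurable fun q : (MeromorphicFun × ℂ) × ℂ => (q.1.1, q.2 + q.1.2) := by fun_prop
  exact ((measurable_sphericalDeriv.comp this).pow_const 2).ennreal_ofReal

/-- The functions for which the image of some disk of integer radius at most `N` around the origin
has relatively small area. -/
def smallArea (ε : ℝ) (N : ℕ) : Set MeromorphicFun :=
  {F | ∃ m : ℕ, 0 < m ∧ m ≤ N ∧ F.imageArea 0 m ≤ ENNReal.ofReal (ε * (m : ℝ) ^ 2)}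

theorem measurableSet_vadd_mem_smallArea (ε : ℝ) (N : ℕ) :
    MeasurableSet {p : MeromorphicFun × ℂ | p.2 +ᵥ p.1 ∈ smallArea ε N} := by
  simp only [smallArea, Set.mem_ofPred_eq, imageArea_vadd, zero_add]
  refine measurableSet_setOfPred.2 (Measurable.exists fun m => measurableSet_setOfPred.1 ?_)
  refine (MeasurableSet.const _).inter ((MeasurableSet.const _).inter ?_)
  exact measurableSet_le (measurable_imageArea m) measurable_const

theorem measurableSet_smallArea (ε : ℝ) (N : ℕ) : MeasurableSet (smallArea ε N) := by
  have : Measurable fun F : MeromorphicFun => (F, (0 : ℂ)) := by fun_prop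
  simpa using this (measurableSet_vadd_mem_smallArea ε N)

/-- Mass transport: by invariance the left side is the same computed at any z, hence equals its
average over the disk of radius N. For each fixed F the covering estimate bounds the integral over
z. -/
theorem setLIntegral_smallArea_le (μ : Measure MeromorphicFun) [IsProbabilityMeasure μ]
    [VAddInvariantMeasure ℂ MeromorphicFun μ] {ε : ℝ} (hε : 0 ≤ ε) (N : ℕ) :
    ∫⁻ F in smallArea ε N, ENNReal.ofReal (F.sphericalDeriv 0 ^ 2) ∂μ ≤
      ENNReal.ofReal (144 * ε) := by
  rcases N.eq_zero_or_pos with rfl | hN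
  · have : smallArea ε 0 = ∅ := by
      ext F
      simp only [smallArea, Set.mem_ofPred_eq, Set.mem_empty_iff_false, iff_false]
      rintro ⟨m, h1, h2, -⟩
      omega
    simp [this]
  set D := Metric.ball (0 : ℂ) N
  set I := ∫⁻ F in smallArea ε N, ENNReal.ofReal (F.sphericalDeriv 0 ^ 2) ∂μ with hI
  have hinv (z : ℂ) : I = ∫⁻ F, {p : MeromorphicFun × ℂ | p.2 +ᵥ p.1 ∈ smallArea ε N}.indicator
      (fun p => ENNReal.ofReal (p.1.sphericalDeriv p.2 ^ 2)) (F, z) ∂μ := by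
    have hmp := measurePreserving_vadd_const μ z
    rw [hI, ← lintegral_indicator (measurableSet_smallArea ε N), ← hmp.lintegral_comp]
    · refine lintegral_congr fun F => ?_
      simp only [Set.indicator, sphericalDeriv_vadd, zero_add]
      rfl
    · exact (((measurable_sphericalDeriv_apply 0).pow_const 2).ennreal_ofReal).indicator
        (measurableSet_smallArea ε N)
  have hmeas : Measurable ({p : MeromorphicFun × ℂ | p.2 +ᵥ p.1 ∈ smallArea ε N}.indicator
      (fun p => ENNReal.ofReal (p.1.sphericalDeriv p.2 ^ 2))) :=
    ((measurable_sphericalDeriv.pow_const 2).ennreal_ofReal).indicator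
      (measurableSet_vadd_mem_smallArea ε N)
  have hfiber (F : MeromorphicFun) : ∫⁻ z in D,
      {p : MeromorphicFun × ℂ | p.2 +ᵥ p.1 ∈ smallArea ε N}.indicator
        (fun p => ENNReal.ofReal (p.1.sphericalDeriv p.2 ^ 2)) (F, z) ≤
      ENNReal.ofReal (144 * ε * (N : ℝ) ^ 2) := by
    have hS : MeasurableSet {z : ℂ | z +ᵥ F ∈ smallArea ε N} :=
      measurable_prodMk_left (x := F) (measurableSet_vadd_mem_smallArea ε N)
    change ∫⁻ z in D, {z : ℂ | z +ᵥ F ∈ smallArea ε N}.indicator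
      (fun z => ENNReal.ofReal (F.sphericalDeriv z ^ 2)) z ≤ _
    rw [lintegral_indicator hS, Measure.restrict_restrict hS]
    refine setLIntegral_le_of_forall_exists_ball hε Set.inter_subset_right ?_
    rintro z ⟨⟨m, hm, hmN, hz⟩, -⟩
    refine ⟨m, by exact_mod_cast hm, by exact_mod_cast hmN, ?_⟩
    rwa [imageArea_vadd, zero_add] at hz
  have hle : volume D * I ≤ ENNReal.ofReal (144 * ε * (N : ℝ) ^ 2) := by
    calc volume D * I = ∫⁻ z in D, I := by rw [setLIntegral_const, mul_comm]
      _ = ∫⁻ z in D, ∫⁻ F, {p : MeromorphicFun × ℂ | p.2 +ᵥ p.1 ∈ smallArea ε N}.indicator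
          (fun p => ENNReal.ofReal (p.1.sphericalDeriv p.2 ^ 2)) (F, z) ∂μ :=
        lintegral_congr hinv
      _ = ∫⁻ F, (∫⁻ z in D, {p : MeromorphicFun × ℂ | p.2 +ᵥ p.1 ∈ smallArea ε N}.indicator
          (fun p => ENNReal.ofReal (p.1.sphericalDeriv p.2 ^ 2)) (F, z)) ∂μ :=
        lintegral_lintegral_swap (hmeas.comp measurable_swap).aemeasurable
      _ ≤ ∫⁻ _, ENNReal.ofReal (144 * ε * (N : ℝ) ^ 2) ∂μ := lintegral_mono hfiber
      _ = _ := by simp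
  have hN' : (0 : ℝ) < (N : ℝ) ^ 2 := by positivity
  -- The factor π in the area is dropped.
  have hD : ENNReal.ofReal ((N : ℝ) ^ 2) ≤ volume D := by
    rw [Complex.volume_ball, ← ENNReal.ofReal_pow (Nat.cast_nonneg N)]
    refine le_mul_of_one_le_right zero_le ?_
    have : (1 : NNReal) ≤ NNReal.pi := by
      rw [← NNReal.coe_le_coe, NNReal.coe_real_pi]
      exact_mod_cast (by linarith [Real.pi_gt_three] : (1 : ℝ) ≤ Real.pi)
    exact_mod_cast this
  have := (mul_le_mul_left hD I).trans hle
  rw [mul_comm (144 * ε), ENNReal.ofReal_mul hN'.le] at this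
  exact (ENNReal.mul_le_mul_iff_right (by simpa using hN.ne') ENNReal.ofReal_ne_top).1 this

/-! ### Functions of zero lower area density -/

/-- The functions for which the lower area density of the images of large disks vanishes. -/
def zeroLowerDensity : Set MeromorphicFun :=
  {F | ∀ ε : ℝ, 0 < ε → ∃ᶠ m : ℕ in atTop, F.imageArea 0 m ≤ ENNReal.ofReal (ε * (m : ℝ) ^ 2)}

theorem imageArea_mono_of_norm_add_le {F : MeromorphicFun} {z : ℂ} {r s : ℝ} (h : r + ‖z‖ ≤ s) :
    F.imageArea z r ≤ F.imageArea 0 s :=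
  lintegral_mono_set (Metric.ball_subset_ball' (by simpa using h))

theorem vadd_mem_zeroLowerDensity {F : MeromorphicFun} (hF : F ∈ zeroLowerDensity) (w : ℂ) :
    w +ᵥ F ∈ zeroLowerDensity := by
  intro ε hε
  obtain ⟨k, hk⟩ := exists_nat_ge ‖w‖
  refine frequently_atTop.2 fun a => ?_
  -- With m = n + k, the bound m ≥ a + 2k gives n ≥ k, so m² ≤ 4n²; this absorbs the 4 in ε / 4.
  obtain ⟨m, hm, hm'⟩ := frequently_atTop.1 (hF (ε / 4) (by positivity)) (a + 2 * k)
  obtain ⟨n, rfl⟩ : ∃ n, m = n + k := ⟨m - k, by omega⟩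
  refine ⟨n, by omega, ?_⟩
  rw [imageArea_vadd, zero_add]
  refine (imageArea_mono_of_norm_add_le ?_).trans (hm'.trans (ENNReal.ofReal_le_ofReal ?_))
  · push_cast
    linarith
  · have h1 : ((n + k : ℕ) : ℝ) ≤ 2 * n := by exact_mod_cast (by omega : n + k ≤ 2 * n)
    have h2 : ((n + k : ℕ) : ℝ) ^ 2 ≤ (2 * n) ^ 2 := by gcongr
    nlinarith

/-- The measure with density F#(0)² gives the set outer measure at most 144 ε for every ε; its
measurability is never needed. -/
theorem ae_sphericalDeriv_zero_eq_zero (μ : Measure MeromorphicFun) [IsProbabilityMeasure μ]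
    [VAddInvariantMeasure ℂ MeromorphicFun μ] :
    ∀ᵐ F ∂μ, F ∈ zeroLowerDensity → F.sphericalDeriv 0 = 0 := by
  have hmeas : Measurable fun F : MeromorphicFun => ENNReal.ofReal (F.sphericalDeriv 0 ^ 2) :=
    ((measurable_sphericalDeriv_apply 0).pow_const 2).ennreal_ofReal
  set ν := μ.withDensity fun F => ENNReal.ofReal (F.sphericalDeriv 0 ^ 2) with hν
  have hle (ε : ℝ) (hε : 0 < ε) : ν zeroLowerDensity ≤ ENNReal.ofReal (144 * ε) := by
    have hsub : zeroLowerDensity ⊆ ⋃ N, smallArea ε N := by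
      intro F hF
      obtain ⟨m, hm, hm'⟩ := frequently_atTop.1 (hF ε hε) 1
      exact Set.mem_iUnion.2 ⟨m, m, hm, le_rfl, hm'⟩
    have hmono : Monotone (smallArea ε) := fun a b hab F ⟨m, h0, hm, h⟩ => ⟨m, h0, hm.trans hab, h⟩
    refine (measure_mono hsub).trans ?_
    rw [hmono.measure_iUnion]
    refine iSup_le fun N => ?_
    rw [hν, withDensity_apply _ (measurableSet_smallArea ε N)]
    exact setLIntegral_smallArea_le μ hε.le N
  have hzero : ν zeroLowerDensity = 0 := by
    refine le_antisymm (ENNReal.le_of_forall_pos_le_add fun δ hδ _ => ?_) zero_le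
    rw [zero_add]
    refine (hle (δ / 144) (by positivity)).trans_eq ?_
    rw [mul_div_cancel₀ _ (by norm_num)]
    exact ENNReal.ofReal_coe_nnreal
  rw [hν, withDensity_apply_eq_zero hmeas] at hzero
  refine (measure_eq_zero_iff_ae_notMem.1 hzero).mono fun F hF hmem => ?_
  by_contra h0
  refine hF ⟨?_, hmem⟩
  simpa using h0

theorem ae_notMem_zeroLowerDensity (μ : Measure MeromorphicFun) [IsProbabilityMeasure μ]
    [VAddInvariantMeasure ℂ MeromorphicFun μ] (hμ : μ constants = 0) :
    ∀ᵐ F ∂μ, F ∉ zeroLowerDensity := by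
  have h (w : ℂ) : ∀ᵐ F ∂μ, F ∈ zeroLowerDensity → F.sphericalDeriv w = 0 := by
    have hmp := measurePreserving_vadd_const μ w
    filter_upwards [hmp.quasiMeasurePreserving.ae (ae_sphericalDeriv_zero_eq_zero μ)] with F hF hmem
    simpa [sphericalDeriv_vadd] using hF (vadd_mem_zeroLowerDensity hmem w)
  have hall := ae_all_iff.2 fun n : ℕ => h (TopologicalSpace.denseSeq ℂ n)
  filter_upwards [hall, measure_eq_zero_iff_ae_notMem.1 hμ] with F hF hc hmem
  refine hc (mem_constants_of_sphericalDeriv_eq_zero fun z => ?_)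
  have heq : F.sphericalDeriv = fun _ => 0 :=
    F.continuous_sphericalDeriv.ext_on (TopologicalSpace.denseRange_denseSeq ℂ) continuous_const
      (by rintro _ ⟨n, rfl⟩; exact hF n hmem)
  exact congrFun heq z

/-! ### From area growth to the characteristic -/

theorem liminf_characteristic_pos {F : MeromorphicFun} (hF : F ∉ zeroLowerDensity) :
    0 < liminf (fun R : ℝ => F.characteristic R / ENNReal.ofReal (R ^ 2)) atTop := by
  obtain ⟨ε, hε, h⟩ : ∃ ε : ℝ, 0 < ε ∧
      ∀ᶠ m : ℕ in atTop, ENNReal.ofReal (ε * (m : ℝ) ^ 2) < F.imageArea 0 m := by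
    simpa [zeroLowerDensity] using hF
  obtain ⟨a, ha⟩ := eventually_atTop.1 h
  -- For r ≥ a + 2 the integer part of r is at least both a and r/2.
  have harea (r : ℝ) (hr : a + 2 ≤ r) : ENNReal.ofReal (ε * r ^ 2 / 4) ≤ F.imageArea 0 r := by
    have hr0 : 0 ≤ r := le_trans (by positivity) hr
    have hfl : (⌊r⌋₊ : ℝ) ≤ r := Nat.floor_le hr0
    have hfl' : r < ⌊r⌋₊ + 1 := Nat.lt_floor_add_one r
    have haf : a ≤ ⌊r⌋₊ := Nat.le_floor (by linarith)
    refine le_trans ?_ ((ha _ haf).le.trans (imageArea_mono_of_norm_add_le (by simpa using hfl)))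
    refine ENNReal.ofReal_le_ofReal ?_
    have h1 : r / 2 ≤ ⌊r⌋₊ := by linarith [(Nat.cast_nonneg a : (0 : ℝ) ≤ a)]
    have h2 : (r / 2) ^ 2 ≤ (⌊r⌋₊ : ℝ) ^ 2 := by gcongr
    nlinarith
  -- On (R/2, R) the integrand is at least εr/(4π) ≥ εR/(8π), and the interval has length R/2.
  have hpos : 0 < ENNReal.ofReal (ε / (16 * Real.pi)) := by
    have := Real.pi_pos
    exact ENNReal.ofReal_pos.2 (by positivity)
  refine hpos.trans_le (le_liminf_of_le (by isBoundedDefault) ?_)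
  filter_upwards [eventually_ge_atTop (2 * ((a : ℝ) + 2))] with R hR
  have hπ := Real.pi_pos
  have hR0 : 0 < R := lt_of_lt_of_le (by positivity) hR
  have hR2 : 0 < R ^ 2 := by positivity
  rw [ENNReal.le_div_iff_mul_le (Or.inl (by simpa using hR0.ne')) (Or.inl ENNReal.ofReal_ne_top),
    ← ENNReal.ofReal_mul (by positivity)]
  calc ENNReal.ofReal (ε / (16 * Real.pi) * R ^ 2)
      = ∫⁻ _ in Set.Ioo (R / 2) R, ENNReal.ofReal (ε * R / (8 * Real.pi)) := by
        rw [setLIntegral_const, Real.volume_Ioo, ← ENNReal.ofReal_mul (by positivity)]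
        congr 1
        field_simp
        ring
    _ ≤ ∫⁻ r in Set.Ioo (R / 2) R, F.sphericalArea r * ENNReal.ofReal (1 / r) := by
        refine setLIntegral_mono_ae' measurableSet_Ioo (Eventually.of_forall fun r hr => ?_)
        have hr0 : 0 < r := lt_trans (by positivity) hr.1
        change _ ≤ ENNReal.ofReal (1 / Real.pi) * F.imageArea 0 r * _
        refine le_trans ?_ (mul_le_mul_left (mul_le_mul_right (harea r (by linarith [hr.1])) _) _)
        rw [← ENNReal.ofReal_mul (by positivity), ← ENNReal.ofReal_mul (by positivity)]
        refine ENNReal.ofReal_le_ofReal ?_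
        have : 1 / Real.pi * (ε * r ^ 2 / 4) * (1 / r) = ε * (2 * r) / (8 * Real.pi) := by
          field_simp
          ring
        rw [this]
        gcongr
        linarith [hr.1]
    _ ≤ F.characteristic R :=
        lintegral_mono_set (Set.Ioo_subset_Ioo_left (by positivity))

end MeromorphicFun

theorem theorem4 (μ : Measure MeromorphicFun) [IsProbabilityMeasure μ]
    (hinv : VAddInvariantMeasure ℂ MeromorphicFun μ)
    (hnontrivial : μ MeromorphicFun.constants = 0) :
    ∀ᵐ F ∂μ, 0 < liminf (fun R : ℝ => F.characteristic R / ENNReal.ofReal (R ^ 2)) atTop :=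
  (MeromorphicFun.ae_notMem_zeroLowerDensity μ hnontrivial).mono fun _ =>
    MeromorphicFun.liminf_characteristic_pos
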